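/- Let $\tau$ be a countable vocabulary, $\mathcal A$ a countable $\tau$-structure. Fix a numbering of the symbols of $\tau$ and let $\tau_s$ be the set of symbols with number less than $s$ (function symbols, if any, are treated as relation symbols for their graphs). For tuples $\bar a,\bar b$ of $\mathcal A$ of the same length, let $\bar a\le_0\bar b$ if $\bar a$ and $\bar b$ satisfy the same quantifier-free $\tau_{|\bar a|}$-formulas in $\mathcal A$, and for an ordinal $\alpha>0$ let \[\bar a\le_\alpha\bar b\iff \forall\beta<\alpha\ \forall\bar d\ \exists\bar c\ \ (\bar b\bar d\le_\beta\bar a\bar c)\qquad(|\bar c|=|\bar d|).\] Write $\bar a\equiv_\alpha\bar b$ if $\bar a\le_\alpha\bar b$ and $\bar b\le_\alpha\bar a$. A tuple $\bar a$ is $\alpha$-free if \[\forall\beta<\alpha\ \forall\bar b\ \exists\bar a'\bar b'\ \ (\bar a\bar b\le_\beta\bar a'\bar b'\ \wedge\ \bar a\not\le_\alpha\bar a'),\] where $|\bar a'|=|\bar a|$ and $|\bar b'|=|\bar b|$. The (parameterless) Scott rank $SR(\mathcal A)$ is the least $\alpha$ such that no tuple of $\mathcal A$ is $\alpha$-free;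 so $SR(\mathcal A)\ge 1$. For a countable ordinal $\alpha>0$ and an injective enumeration $(\bar a_i)_{i\in I}$ of representatives of the $\equiv_\alpha$-classes of tuples of $\mathcal A$, the canonical structural $\alpha$-jump $\mathcal A_{(\alpha)}$ is the expansion of $\mathcal A$ by relation symbols $R_i$ ($i\in I$) of arity $|\bar a_i|$, with $R_i(\bar b)$ if and only if $\bar a_i\le_\alpha\bar b$. Let $0<\alpha,\beta<\omega_1$. Then, for every choice of the enumeration $(\bar a_i)_{i\in I}$ and of the numberings of the symbols of $\tau$ and of the vocabulary of $\mathcal A_{(\alpha)}$: (1) if $\beta>1$ or $SR(\mathcal A)>\alpha$, then $SR(\mathcal A)=\alpha+\beta$ if and only if $SR(\mathcal A_{(\alpha)})=\beta$; (2) if $SR(\mathcal A)\le\alpha$, then $SR(\mathcal A_{(\alpha)})=1$. -/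

import Mathlib

open FirstOrder FirstOrder.Language
open scoped Ordinal

universe u v w x

namespace ScottJump

section BackAndForth

variable {L : FirstOrder.Language.{u, v}} {M : Type w} [L.Structure M]

/-- Let `τ_s` be the finite set of symbols of `L` whose number under `e` is less than `s`.
`AtomicAgree e a b` says that the `n`-tuples `a` and `b` satisfy the same quantifier-free
`τ_n`-formulas: the same equalities between coordinates, and the same instances of the symbols in
`τ_n` at coordinates. Function symbols are read as their graphs, as usual in this setting. -/
def AtomicAgree (e : L.Symbols ↪ ℕ) {n : ℕ} (a b : Fin n → M) : Prop :=
  (∀ i j : Fin n, a i = a j ↔ b i = b j) ∧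
  (∀ (k : ℕ) (R : L.Relations k), e (Sum.inr ⟨k, R⟩) < n → ∀ σ : Fin k → Fin n,
    (Structure.RelMap R (a ∘ σ) ↔ Structure.RelMap R (b ∘ σ))) ∧
  (∀ (k : ℕ) (f : L.Functions k), e (Sum.inl ⟨k, f⟩) < n → ∀ (σ : Fin k → Fin n) (j : Fin n),
    (Structure.funMap f (a ∘ σ) = a j ↔ Structure.funMap f (b ∘ σ) = b j))

/-- The back-and-forth relation `a ≤_α b` between tuples of the same length of one structure. -/
def BFLe (e : L.Symbols ↪ ℕ) (α : Ordinal.{0}) {n : ℕ} (a b : Fin n → M) : Prop :=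
  (α = 0 → AtomicAgree e a b) ∧
  ∀ (β : Ordinal.{0}) (_ : β < α) (m : ℕ) (d : Fin m → M), ∃ c : Fin m → M,
    BFLe e β (Fin.append b d) (Fin.append a c)
termination_by α

/-- `a ≡_α b`: back-and-forth equivalence of tuples of the same length. -/
def BFEquiv (e : L.Symbols ↪ ℕ) (α : Ordinal.{0}) {n : ℕ} (a b : Fin n → M) : Prop :=
  BFLe e α a b ∧ BFLe e α b a

/-- The tuple `a` is `α`-free. -/
def IsFree (e : L.Symbols ↪ ℕ) (α : Ordinal.{0}) {n : ℕ} (a : Fin n → M) : Prop :=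
  ∀ β < α, ∀ (m : ℕ) (b : Fin m → M), ∃ (a' : Fin n → M) (b' : Fin m → M),
    BFLe e β (Fin.append a b) (Fin.append a' b') ∧ ¬ BFLe e α a a'

variable (M) in
/-- The (parameterless) Scott rank of a countable structure: the least `α` such that no tuple is
`α`-free. As every tuple is `0`-free, it is at least `1`. -/
noncomputable def scottRank (e : L.Symbols ↪ ℕ) : Ordinal.{0} :=
  sInf {α : Ordinal.{0} | ∀ (n : ℕ) (a : Fin n → M), ¬ IsFree e α a}

/-- The family of tuples `a i` (of length `len i`) is an injective enumeration of representatives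
of the `α`-back-and-forth equivalence classes: every tuple is equivalent to exactly one `a i`. -/
def IsBFEnumeration (e : L.Symbols ↪ ℕ) (α : Ordinal.{0}) {ι : Type x} (len : ι → ℕ)
    (a : (i : ι) → Fin (len i) → M) : Prop :=
  ∀ (n : ℕ) (b : Fin n → M), ∃! i : ι, ∃ h : n = len i, BFEquiv e α (a i ∘ Fin.cast h) b

end BackAndForth

/-- The new symbols of the jump: one relation symbol `R_i` of arity `len i` for each index `i`. -/
def jumpSymbols {ι : Type x} (len : ι → ℕ) : FirstOrder.Language.{0, x} where
  Functions := fun _ => Empty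
  Relations := fun n => {i : ι // len i = n}

/-- The vocabulary `τ_(α)`: the vocabulary `τ = L` together with the symbols `R_i`. -/
abbrev jumpLanguage (L : FirstOrder.Language.{u, v}) {ι : Type x} (len : ι → ℕ) :
    FirstOrder.Language.{u, max v x} :=
  L.sum (jumpSymbols len)

/-- The universe of the canonical structural `α`-jump built from the enumeration `a`; it is the
universe of the original structure. -/
@[nolint unusedArguments]
def StructuralJump {L : FirstOrder.Language.{u, v}} {M : Type w} [L.Structure M]
    (_e : L.Symbols ↪ ℕ) (_α : Ordinal.{0}) {ι : Type x} {len : ι → ℕ} (_a : (i : ι) → Fin (len i) → M) : Type w := M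

/-- The canonical structural `α`-jump: the symbols of `L` keep their interpretation, and
`R_i b` holds if and only if `a i ≤_α b`. -/
instance {L : FirstOrder.Language.{u, v}} {M : Type w} [L.Structure M] (e : L.Symbols ↪ ℕ)
    (α : Ordinal.{0}) {ι : Type x} {len : ι → ℕ} (a : (i : ι) → Fin (len i) → M) :
    (jumpLanguage L len).Structure (StructuralJump e α a) where
  funMap := fun {_} f y => match f with
    | Sum.inl g => (Structure.funMap g (M := M) y : M)
    | Sum.inr g => nomatch g
  RelMap := fun {_} R b => match R with
    | Sum.inl S => Structure.RelMap S (M := M) b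
    | Sum.inr i => BFLe (M := M) e α (a i.1) (b ∘ Fin.cast i.2)

end ScottJump

/-! For `β > 0` the relation `≤_β` of the jump is `≤_{α+β}` of the original structure. For `β = 0`
this may fail, as `≤_0` on `n`-tuples sees only the symbols numbered below `n`. It still holds up to
lengthening the left tuple by a fixed block: padding brings the relevant `R_i` into view, and
conversely a finite block of witnesses lets `≤_α` decide the finitely many visible instances. Each
back-and-forth or freeness step can carry such a block along, so the defect disappears above 0
(`bfLe_jump_iff_and_exists_append`) and freeness transfers (`isFree_jump_iff`). Hence the jump has
Scott rank `max 1 (SR - α)`, and the theorem is ordinal arithmetic. -/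

namespace ScottJump

/-! ### Back-and-forth relations and Scott rank in one structure. -/

section Basic

variable {L : FirstOrder.Language.{u, v}} {M : Type w} [L.Structure M] {e : L.Symbols ↪ ℕ}
  {n m k : ℕ} {α β : Ordinal.{0}}

theorem bfLe_zero {a b : Fin n → M} : BFLe e 0 a b ↔ AtomicAgree e a b := by
  rw [BFLe]
  simp

theorem bfLe_of_pos (hα : 0 < α) {a b : Fin n → M} :
    BFLe e α a b ↔ ∀ β < α, ∀ (m : ℕ) (d : Fin m → M), ∃ c : Fin m → M,
      BFLe e β (Fin.append b d) (Fin.append a c) := by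
  rw [BFLe]
  simp [hα.ne']

theorem AtomicAgree.refl (a : Fin n → M) : AtomicAgree e a a :=
  ⟨fun _ _ => Iff.rfl, fun _ _ _ _ => Iff.rfl, fun _ _ _ _ _ => Iff.rfl⟩

theorem AtomicAgree.symm {a b : Fin n → M} (h : AtomicAgree e a b) : AtomicAgree e b a :=
  ⟨fun i j => (h.1 i j).symm, fun k R hR σ => (h.2.1 k R hR σ).symm,
    fun k f hf σ j => (h.2.2 k f hf σ j).symm⟩

theorem AtomicAgree.trans {a b c : Fin n → M} (h : AtomicAgree e a b) (h' : AtomicAgree e b c) :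
    AtomicAgree e a c :=
  ⟨fun i j => (h.1 i j).trans (h'.1 i j), fun k R hR σ => (h.2.1 k R hR σ).trans (h'.2.1 k R hR σ),
    fun k f hf σ j => (h.2.2 k f hf σ j).trans (h'.2.2 k f hf σ j)⟩

/-- The bound `k ≤ n` keeps the symbols visible at length `k` among those visible at length `n`. -/
theorem AtomicAgree.comp {a b : Fin n → M} (h : AtomicAgree e a b) (hk : k ≤ n)
    (σ : Fin k → Fin n) : AtomicAgree e (a ∘ σ) (b ∘ σ) :=
  ⟨fun _ _ => h.1 _ _, fun l R hR ρ => h.2.1 l R (hR.trans_le hk) (σ ∘ ρ),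
    fun l f hf ρ j => h.2.2 l f (hf.trans_le hk) (σ ∘ ρ) (σ j)⟩

theorem append_comp_left (a : Fin n → M) (d : Fin m → M) (σ : Fin k → Fin n) :
    Fin.append (a ∘ σ) d =
      Fin.append a d ∘ finSumFinEquiv ∘ Sum.map σ id ∘ finSumFinEquiv.symm := by
  funext i
  refine Fin.addCases (fun i => ?_) (fun i => ?_) i <;> simp

theorem append_comp_castAdd (a : Fin n → M) (d : Fin m → M) :
    Fin.append a d ∘ Fin.castAdd m = a :=
  funext fun i => Fin.append_left a d i

theorem append_comp_natAdd (a : Fin n → M) (d : Fin m → M) :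
    Fin.append a d ∘ Fin.natAdd n = d :=
  funext fun i => Fin.append_right a d i

/-- Back-and-forth relations pass to subtuples. -/
theorem BFLe.comp_injective {a b : Fin n → M} (h : BFLe e α a b) {σ : Fin k → Fin n}
    (hσ : Function.Injective σ) : BFLe e α (a ∘ σ) (b ∘ σ) := by
  induction α using WellFoundedLT.induction generalizing n k with
  | ind α ih =>
    rcases eq_or_ne α 0 with rfl | hα
    · rw [bfLe_zero] at h ⊢
      exact h.comp (by simpa using Fintype.card_le_of_injective σ hσ) σ
    · have hα := pos_iff_ne_zero.2 hα
      rw [bfLe_of_pos hα] at h ⊢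
      intro β hβ m d
      obtain ⟨c, hc⟩ := h β hβ m d
      refine ⟨c, ?_⟩
      rw [append_comp_left, append_comp_left]
      exact ih β hβ hc (finSumFinEquiv.injective.comp
        ((hσ.sumMap Function.injective_id).comp finSumFinEquiv.symm.injective))

theorem BFLe.of_append {a b : Fin n → M} {c d : Fin m → M}
    (h : BFLe e α (Fin.append a c) (Fin.append b d)) : BFLe e α a b := by
  have := h.comp_injective (Fin.castAdd_injective n m)
  rwa [append_comp_castAdd, append_comp_castAdd] at this

/-- A step down to 0 with no new elements reverses the two tuples; atomic agreement is symmetric. -/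
theorem BFLe.atomicAgree {a b : Fin n → M} (h : BFLe e α a b) : AtomicAgree e a b := by
  induction α using WellFoundedLT.induction generalizing a b with
  | ind α ih =>
    rcases eq_or_ne α 0 with rfl | hα
    · exact bfLe_zero.1 h
    · have hα := pos_iff_ne_zero.2 hα
      obtain ⟨c, hc⟩ := (bfLe_of_pos hα).1 h 0 hα 0 Fin.elim0
      exact (ih 0 hα hc.of_append).symm

theorem BFLe.mono {a b : Fin n → M} (h : BFLe e α a b) (hβ : β ≤ α) : BFLe e β a b := by
  rcases eq_or_ne β 0 with rfl | hβ₀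
  · exact bfLe_zero.2 h.atomicAgree
  · have hβ₀ := pos_iff_ne_zero.2 hβ₀
    rw [bfLe_of_pos hβ₀]
    exact fun γ hγ => (bfLe_of_pos (hβ₀.trans_le hβ)).1 h γ (hγ.trans_le hβ)

theorem BFLe.refl (a : Fin n → M) : BFLe e α a a := by
  induction α using WellFoundedLT.induction generalizing n with
  | ind α ih =>
    rcases eq_or_ne α 0 with rfl | hα
    · exact bfLe_zero.2 (.refl a)
    · rw [bfLe_of_pos (pos_iff_ne_zero.2 hα)]
      exact fun β hβ m d => ⟨d, ih β hβ _⟩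

theorem BFLe.trans {a b c : Fin n → M} (h : BFLe e α a b) (h' : BFLe e α b c) :
    BFLe e α a c := by
  induction α using WellFoundedLT.induction generalizing n with
  | ind α ih =>
    rcases eq_or_ne α 0 with rfl | hα
    · exact bfLe_zero.2 ((bfLe_zero.1 h).trans (bfLe_zero.1 h'))
    · rw [bfLe_of_pos (pos_iff_ne_zero.2 hα)] at h h' ⊢
      intro β hβ m d
      obtain ⟨p, hp⟩ := h' β hβ m d
      obtain ⟨q, hq⟩ := h β hβ m p
      exact ⟨q, ih β hβ hp hq⟩

theorem BFLe.append_assoc {a b : Fin n → M} {c d : Fin m → M} {p q : Fin k → M}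
    (h : BFLe e α (Fin.append a (Fin.append c p)) (Fin.append b (Fin.append d q))) :
    BFLe e α (Fin.append (Fin.append a c) p) (Fin.append (Fin.append b d) q) := by
  rw [Fin.append_assoc, Fin.append_assoc]
  exact h.comp_injective (Fin.cast_injective _)

theorem append_split (c : Fin (m + k) → M) :
    Fin.append (c ∘ Fin.castAdd k) (c ∘ Fin.natAdd m) = c :=
  Fin.append_castAdd_natAdd

/-- In a back-and-forth step the new elements may be given in two blocks. -/
theorem BFLe.exists_append_append {a b : Fin n → M} (h : BFLe e α a b) (hβ : β < α)
    (d : Fin m → M) (p : Fin k → M) : ∃ (c : Fin m → M) (q : Fin k → M),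
      BFLe e β (Fin.append (Fin.append b d) p) (Fin.append (Fin.append a c) q) := by
  obtain ⟨c, hc⟩ := (bfLe_of_pos (pos_of_gt hβ)).1 h β hβ _ (Fin.append d p)
  rw [← append_split c] at hc
  exact ⟨_, _, hc.append_assoc⟩

theorem IsFree.exists_append_append {a : Fin n → M} (h : IsFree e α a) (hβ : β < α)
    (b : Fin m → M) (p : Fin k → M) : ∃ (a' : Fin n → M) (b' : Fin m → M) (q : Fin k → M),
      BFLe e β (Fin.append (Fin.append a b) p) (Fin.append (Fin.append a' b') q) ∧
        ¬ BFLe e α a a' := by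
  obtain ⟨a', c, hc, hn⟩ := h β hβ _ (Fin.append b p)
  rw [← append_split c] at hc
  exact ⟨_, _, _, hc.append_assoc, hn⟩

/-- For positive ordinals, back-and-forth relations are stable under arbitrary reindexing. -/
theorem BFLe.comp (hα : 0 < α) {a b : Fin n → M} (h : BFLe e α a b) (σ : Fin k → Fin n) :
    BFLe e α (a ∘ σ) (b ∘ σ) := by
  rw [bfLe_of_pos hα]
  intro β hβ m d
  -- Playing a second copy of `b ∘ σ` makes the reindexing injective; the equality types force the
  -- answer `a ∘ σ`.
  obtain ⟨q, c, hc⟩ := h.exists_append_append hβ (b ∘ σ) d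
  have hq : q = a ∘ σ := by
    funext i
    have := (hc.atomicAgree.1 (Fin.castAdd m (Fin.natAdd n i))
      (Fin.castAdd m (Fin.castAdd k (σ i)))).1 (by simp)
    simpa using this
  subst hq
  refine ⟨c, ?_⟩
  have h' := hc.comp_injective (σ := finSumFinEquiv ∘ Sum.map (Fin.natAdd n) id ∘
    finSumFinEquiv.symm) (finSumFinEquiv.injective.comp
      (((Fin.natAdd_injective k n).sumMap Function.injective_id).comp
        finSumFinEquiv.symm.injective))
  rw [← append_comp_left, ← append_comp_left] at h'
  simpa [append_comp_natAdd] using h'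

/-- For positive ordinals, the back-and-forth relation gives extensions by arbitrarily long tuples
that still satisfy the same atomic formulas. -/
theorem BFLe.exists_atomicAgree_append (hα : 0 < α) {a b : Fin n → M} (h : BFLe e α a b) (N : ℕ) :
    a = b ∨ ∃ (m : ℕ) (c d : Fin m → M), N < n + m ∧
      AtomicAgree e (Fin.append a c) (Fin.append b d) := by
  rcases isEmpty_or_nonempty M with _ | ⟨⟨z⟩⟩
  · exact Or.inl (Subsingleton.elim a b)
  · obtain ⟨c, hc⟩ := (bfLe_of_pos hα).1 h 0 hα (N + 1) (fun _ => z)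
    exact Or.inr ⟨N + 1, c, _, by omega, hc.atomicAgree.symm⟩

/-- Padding the tuples past the number of `R` removes the restriction on visible symbols. -/
theorem BFLe.relMap_iff (hα : 0 < α) {a b : Fin n → M} (h : BFLe e α a b) (R : L.Relations k)
    (σ : Fin k → Fin n) : Structure.RelMap R (a ∘ σ) ↔ Structure.RelMap R (b ∘ σ) := by
  obtain rfl | ⟨m, c, d, hN, H⟩ := h.exists_atomicAgree_append hα (e (Sum.inr ⟨k, R⟩))
  · rfl
  · simpa [← Function.comp_assoc, append_comp_castAdd] using H.2.1 k R hN (Fin.castAdd _ ∘ σ)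

theorem BFLe.funMap_eq_iff (hα : 0 < α) {a b : Fin n → M} (h : BFLe e α a b) (f : L.Functions k)
    (σ : Fin k → Fin n) (j : Fin n) :
    Structure.funMap f (a ∘ σ) = a j ↔ Structure.funMap f (b ∘ σ) = b j := by
  obtain rfl | ⟨m, c, d, hN, H⟩ := h.exists_atomicAgree_append hα (e (Sum.inl ⟨k, f⟩))
  · rfl
  · simpa [← Function.comp_assoc, append_comp_castAdd] using
      H.2.2 k f hN (Fin.castAdd _ ∘ σ) (Fin.castAdd _ j)

/-- Finitely many properties, each forced by `≤_α` on some extension of `a`, are forced together by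
`≤_α` on one extension of `a`. -/
theorem exists_append_forces_all {T : Type*} [Finite T] (a : Fin n → M) (P : T → (Fin n → M) → Prop)
    (h : ∀ t, ∃ (m : ℕ) (p : Fin m → M), ∀ (b : Fin n → M) (q : Fin m → M),
      BFLe e α (Fin.append a p) (Fin.append b q) → P t b) :
    ∃ (m : ℕ) (p : Fin m → M), ∀ (b : Fin n → M) (q : Fin m → M),
      BFLe e α (Fin.append a p) (Fin.append b q) → ∀ t, P t b := by
  suffices H : ∀ s : Set T, s.Finite → ∃ (m : ℕ) (p : Fin m → M), ∀ (b : Fin n → M)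
      (q : Fin m → M), BFLe e α (Fin.append a p) (Fin.append b q) → ∀ t ∈ s, P t b by
    simpa using H Set.univ Set.finite_univ
  intro s hs
  induction s, hs using Set.Finite.induction_on with
  | empty => exact ⟨0, Fin.elim0, by simp⟩
  | @insert t s _ _ ih =>
    obtain ⟨m, p, hp⟩ := ih
    obtain ⟨m', p', hp'⟩ := h t
    refine ⟨m + m', Fin.append p p', fun b q hq => ?_⟩
    rw [← append_split q] at hq
    have hq₁ := hq.append_assoc.of_append
    have hq₂ := hq.comp_injective (σ := finSumFinEquiv ∘ Sum.map id (Fin.natAdd m) ∘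
      finSumFinEquiv.symm) (finSumFinEquiv.injective.comp
        ((Function.injective_id.sumMap (Fin.natAdd_injective m' m)).comp
          finSumFinEquiv.symm.injective))
    have hcomp (x : Fin n → M) (y : Fin m → M) (z : Fin m' → M) :
        Fin.append x (Fin.append y z) ∘ finSumFinEquiv ∘ Sum.map id (Fin.natAdd m) ∘
          finSumFinEquiv.symm = Fin.append x z := by
      funext i
      refine Fin.addCases (fun i => ?_) (fun i => ?_) i <;> simp
    rw [hcomp, hcomp] at hq₂
    rintro r (rfl | hr)
    · exact hp' b _ hq₂
    · exact hp b _ hq₁ r hr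

/-- If no tuple is `α`-free, then the relation `≤_α` is contained in all `≤_β`. -/
theorem BFLe.of_forall_not_isFree (hα : ∀ (n : ℕ) (a : Fin n → M), ¬ IsFree e α a)
    {a b : Fin n → M} (h : BFLe e α a b) : BFLe e β a b := by
  induction β using WellFoundedLT.induction generalizing n with
  | ind β ih =>
    rcases eq_or_ne β 0 with rfl | hβ
    · exact h.mono zero_le
    rw [bfLe_of_pos (pos_iff_ne_zero.2 hβ)]
    intro γ hγ m d
    -- Non-freeness of `b d` gives `δ < α` and a block `p` through which `≤_δ` already forces `≤_α`;
    -- playing `d` with `p` restores the hypothesis for the smaller ordinal `γ`.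
    have hf := hα _ (Fin.append b d)
    simp only [IsFree] at hf
    push Not at hf
    obtain ⟨δ, hδ, l, p, hp⟩ := hf
    obtain ⟨c, q, hc⟩ := h.exists_append_append hδ d p
    exact ⟨c, ih γ hγ (hp _ _ hc)⟩

theorem forall_not_isFree_mono (hαβ : α ≤ β) (hα : ∀ (n : ℕ) (a : Fin n → M), ¬ IsFree e α a)
    (n : ℕ) (a : Fin n → M) : ¬ IsFree e β a := by
  have hf := hα n a
  simp only [IsFree] at hf ⊢
  push Not at hf ⊢
  obtain ⟨γ, hγ, m, b, hb⟩ := hf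
  exact ⟨γ, hγ.trans_le hαβ, m, b, fun a' b' h => (hb a' b' h).of_forall_not_isFree hα⟩

/-- A `β`-free tuple separates `≤_β` from every earlier relation. Were there one for each `β`, the
ordinals would inject into the sets of pairs of tuples, which are too few. -/
theorem exists_forall_not_isFree [Countable M] (e : L.Symbols ↪ ℕ) :
    ∃ α : Ordinal.{0}, ∀ (n : ℕ) (a : Fin n → M), ¬ IsFree e α a := by
  by_contra! H
  let F : Ordinal.{0} → Set (Σ n : ℕ, (Fin n → M) × (Fin n → M)) :=
    fun α => {t | BFLe e α t.2.1 t.2.2}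
  have hF : ∀ α β, α < β → F α ≠ F β := by
    intro α β hαβ hEq
    obtain ⟨n, a, ha⟩ := H β
    obtain ⟨a', b', h, hn⟩ := ha α hαβ 0 Fin.elim0
    have : (⟨n, a, a'⟩ : Σ n : ℕ, (Fin n → M) × (Fin n → M)) ∈ F α := h.of_append
    rw [hEq] at this
    exact hn this
  refine not_injective_of_ordinal F fun α β h => ?_
  rcases lt_trichotomy α β with hlt | heq | hlt
  · exact (hF _ _ hlt h).elim
  · exact heq
  · exact (hF _ _ hlt h.symm).elim

theorem not_isFree_scottRank [Countable M] (e : L.Symbols ↪ ℕ) (a : Fin n → M) :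
    ¬ IsFree e (scottRank M e) a :=
  csInf_mem (exists_forall_not_isFree e) n a

theorem scottRank_le_iff [Countable M] : scottRank M e ≤ α ↔
    ∀ (n : ℕ) (a : Fin n → M), ¬ IsFree e α a :=
  ⟨fun h => forall_not_isFree_mono h fun _ => not_isFree_scottRank e, fun h => csInf_le' h⟩

theorem scottRank_pos [Countable M] (e : L.Symbols ↪ ℕ) : 0 < scottRank M e := by
  rw [← not_le, scottRank_le_iff]
  exact fun h => h 0 Fin.elim0 fun β hβ => (not_lt_zero hβ).elim

end Basic

/-! ### Comparison of the jump with the original structure. -/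

section Jump

variable {L : FirstOrder.Language.{u, v}} {M : Type w} [L.Structure M] {e : L.Symbols ↪ ℕ}
  {n k : ℕ} {α β : Ordinal.{0}} {ι : Type x} {len : ι → ℕ} {a : (i : ι) → Fin (len i) → M}

/-- The value of a relation of the jump at a subtuple of `b` is decided by `≤_α` on some extension
of `b`. -/
theorem exists_append_relMap_jump (hα : 0 < α) (a : (i : ι) → Fin (len i) → M)
    (R : (jumpLanguage L len).Relations k) (b : Fin n → M) (σ : Fin k → Fin n) :
    ∃ (m : ℕ) (p : Fin m → M), ∀ (c : Fin n → M) (q : Fin m → M),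
      BFLe e α (Fin.append b p) (Fin.append c q) →
        (Structure.RelMap (M := StructuralJump e α a) R (b ∘ σ) ↔
          Structure.RelMap (M := StructuralJump e α a) R (c ∘ σ)) := by
  rcases R with S | i
  · exact ⟨0, Fin.elim0, fun c q h => h.of_append.relMap_iff hα S σ⟩
  · change ∃ (m : ℕ) (p : Fin m → M), ∀ (c : Fin n → M) (q : Fin m → M),
      BFLe e α (Fin.append b p) (Fin.append c q) →
        (BFLe e α (a i.1) (b ∘ σ ∘ Fin.cast i.2) ↔ BFLe e α (a i.1) (c ∘ σ ∘ Fin.cast i.2))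
    generalize σ ∘ Fin.cast i.2 = ρ
    by_cases hb : BFLe e α (a i.1) (b ∘ ρ)
    · exact ⟨0, Fin.elim0, fun c q h =>
        iff_of_true hb (hb.trans (h.of_append.comp hα ρ))⟩
    -- A block `p` witnessing that `R_i` fails at `b ∘ ρ` is appended to `b`: were `R_i` true at `c
    -- ∘ ρ`, the answer to `q` would also answer `p`.
    · have hb' := hb
      rw [bfLe_of_pos hα] at hb'
      push Not at hb'
      obtain ⟨γ, hγ, m, p, hp⟩ := hb'
      refine ⟨m, p, fun c q h => iff_of_false hb fun hc => ?_⟩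
      obtain ⟨r, hr⟩ := (bfLe_of_pos hα).1 hc γ hγ m q
      have h' := h.comp hα (finSumFinEquiv ∘ Sum.map ρ id ∘ finSumFinEquiv.symm)
      rw [← append_comp_left, ← append_comp_left] at h'
      exact hp r ((h'.mono hγ.le).trans hr)

theorem exists_append_atomicAgree_jump (hα : 0 < α) (a : (i : ι) → Fin (len i) → M)
    (e' : (jumpLanguage L len).Symbols ↪ ℕ) (b : Fin n → M) :
    ∃ (m : ℕ) (p : Fin m → M), ∀ (c : Fin n → M) (q : Fin m → M),
      BFLe e α (Fin.append b p) (Fin.append c q) →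
        AtomicAgree (M := StructuralJump e α a) e' b c := by
  have hfin : Finite {s : Σ k, (jumpLanguage L len).Relations k // e' (Sum.inr s) < n} :=
    Finite.of_injective (fun s => (⟨e' (Sum.inr s.1), s.2⟩ : Fin n)) fun s t h =>
      Subtype.ext (Sum.inr_injective (e'.injective (Fin.mk.inj_iff.1 h)))
  obtain ⟨m, p, hp⟩ := exists_append_forces_all (e := e) (α := α)
    (T := Σ s : {s : Σ k, (jumpLanguage L len).Relations k // e' (Sum.inr s) < n},
      Fin s.1.1 → Fin n) b _ fun t => exists_append_relMap_jump hα a t.1.1.2 b t.2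
  refine ⟨m, p, fun c q h => ⟨h.of_append.atomicAgree.1, fun k R hR σ => ?_, ?_⟩⟩
  · exact hp c q h ⟨⟨⟨k, R⟩, hR⟩, σ⟩
  · rintro k (f | f) - σ j
    · exact h.of_append.funMap_eq_iff hα f σ j
    · exact f.elim

/-- For the representative `a i` of the class of `b`, `R_i` holds at `b`, hence at `c` once it is
visible; then `b ≤_α a i ≤_α c`. -/
theorem exists_append_bfLe_of_atomicAgree_jump (ha : IsBFEnumeration e α len a)
    (e' : (jumpLanguage L len).Symbols ↪ ℕ) (b : Fin n → M) :
    ∃ (m : ℕ) (p : Fin m → M), ∀ (c : Fin n → M) (q : Fin m → M),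
      AtomicAgree (M := StructuralJump e α a) e' (Fin.append b p) (Fin.append c q) →
        BFLe e α b c := by
  rcases isEmpty_or_nonempty M with _ | ⟨⟨z⟩⟩
  · exact ⟨0, Fin.elim0, fun c q _ => by rw [Subsingleton.elim c b]; exact .refl b⟩
  · obtain ⟨i, ⟨rfl, hi⟩, -⟩ := ha n b
    let R : (jumpLanguage L len).Relations (len i) := Sum.inr ⟨i, rfl⟩
    -- The padded length strictly exceeds the number of `R_i`.
    refine ⟨e' (Sum.inr ⟨len i, R⟩) + 1, fun _ => z, fun c q h => ?_⟩
    have hR : BFLe e α (a i) (Fin.append b (fun _ => z) ∘ Fin.castAdd _) ↔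
      BFLe e α (a i) (Fin.append c q ∘ Fin.castAdd _) := h.2.1 _ R (by omega) (Fin.castAdd _)
    rw [append_comp_castAdd, append_comp_castAdd] at hR
    exact hi.2.trans (hR.1 hi.1)

/-- The induction uses only the two weak forms below `β`, which include 0; a strong form at `β`
implies both with an empty block. -/
theorem bfLe_jump_iff_and_exists_append (hα : 0 < α) (ha : IsBFEnumeration e α len a)
    (e' : (jumpLanguage L len).Symbols ↪ ℕ) (β : Ordinal.{0}) :
    (0 < β → ∀ (n : ℕ) (b c : Fin n → M),
      BFLe (M := StructuralJump e α a) e' β b c ↔ BFLe e (α + β) b c) ∧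
    (∀ (n : ℕ) (b : Fin n → M), ∃ (m : ℕ) (p : Fin m → M), ∀ (c : Fin n → M) (q : Fin m → M),
      BFLe (M := StructuralJump e α a) e' β (Fin.append b p) (Fin.append c q) →
        BFLe e (α + β) b c) ∧
    (∀ (n : ℕ) (b : Fin n → M), ∃ (m : ℕ) (p : Fin m → M), ∀ (c : Fin n → M) (q : Fin m → M),
      BFLe e (α + β) (Fin.append b p) (Fin.append c q) →
        BFLe (M := StructuralJump e α a) e' β b c) := by
  induction β using WellFoundedLT.induction with
  | ind β ih =>
    rcases eq_or_ne β 0 with rfl | hβ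
    · refine ⟨fun h => h.false.elim, fun n b => ?_, fun n b => ?_⟩
      · obtain ⟨m, p, hp⟩ := exists_append_bfLe_of_atomicAgree_jump ha e' b
        exact ⟨m, p, fun c q h => (add_zero α).symm ▸ hp c q (bfLe_zero.1 h)⟩
      · obtain ⟨m, p, hp⟩ := exists_append_atomicAgree_jump hα a e' b
        exact ⟨m, p, fun c q h => bfLe_zero.2 (hp c q (add_zero α ▸ h))⟩
    have hβ₀ := pos_iff_ne_zero.2 hβ
    have key (n : ℕ) (b c : Fin n → M) :
        BFLe (M := StructuralJump e α a) e' β b c ↔ BFLe e (α + β) b c := by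
      constructor
      · intro h
        rw [bfLe_of_pos (hα.trans_le le_self_add)]
        intro δ hδ m d
        -- Every `δ < α + β` lies below some `α + γ` with `γ < β`, including all `δ ≤ α` (take `γ =
        -- 0`).
        obtain ⟨γ, hγ, hδγ⟩ := (Ordinal.lt_add_iff hβ).1 hδ
        obtain ⟨k, p, hp⟩ := (ih γ hγ).2.1 _ (Fin.append c d)
        obtain ⟨r, q, hq⟩ := h.exists_append_append hγ d p
        exact ⟨r, (hp _ q hq).mono hδγ⟩
      · intro h
        refine (bfLe_of_pos hβ₀).2 fun γ hγ m d => ?_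
        obtain ⟨k, p, hp⟩ := (ih γ hγ).2.2 _ (Fin.append c d)
        obtain ⟨r, q, hq⟩ := h.exists_append_append (add_lt_add_right hγ α) d p
        exact ⟨r, hp _ q hq⟩
    exact ⟨fun _ => key,
      fun n b => ⟨0, Fin.elim0, fun c q h => (key n b c).1 h.of_append⟩,
      fun n b => ⟨0, Fin.elim0, fun c q h => (key n b c).2 h.of_append⟩⟩

/-- For positive `β`, the relation `≤_β` of the `α`-jump is the relation `≤_{α + β}`. -/
theorem bfLe_jump_iff (hα : 0 < α) (hβ : 0 < β) (ha : IsBFEnumeration e α len a)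
    (e' : (jumpLanguage L len).Symbols ↪ ℕ) (b c : Fin n → M) :
    BFLe (M := StructuralJump e α a) e' β b c ↔ BFLe e (α + β) b c :=
  (bfLe_jump_iff_and_exists_append hα ha e' β).1 hβ n b c

/-- For positive `β`, the `β`-free tuples of the `α`-jump are the `α + β`-free tuples. -/
theorem isFree_jump_iff (hα : 0 < α) (hβ : 0 < β) (ha : IsBFEnumeration e α len a)
    (e' : (jumpLanguage L len).Symbols ↪ ℕ) (b : Fin n → M) :
    IsFree (M := StructuralJump e α a) e' β b ↔ IsFree e (α + β) b := by
  constructor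
  · intro h δ hδ m d
    obtain ⟨γ, hγ, hδγ⟩ := (Ordinal.lt_add_iff hβ.ne').1 hδ
    obtain ⟨k, p, hp⟩ := (bfLe_jump_iff_and_exists_append hα ha e' γ).2.1 _ (Fin.append b d)
    obtain ⟨b', d', q, hq, hn⟩ := h.exists_append_append hγ d p
    exact ⟨b', d', (hp _ q hq).mono hδγ, fun h' => hn ((bfLe_jump_iff hα hβ ha e' b b').2 h')⟩
  · intro h γ hγ m d
    obtain ⟨k, p, hp⟩ := (bfLe_jump_iff_and_exists_append hα ha e' γ).2.2 _ (Fin.append b d)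
    obtain ⟨b', d', q, hq, hn⟩ := h.exists_append_append (add_lt_add_right hγ α) d p
    exact ⟨b', d', hp _ q hq, fun h' => hn ((bfLe_jump_iff hα hβ ha e' b b').1 h')⟩

instance [Countable M] : Countable (StructuralJump e α a) :=
  inferInstanceAs (Countable M)

theorem scottRank_jump_le_iff [Countable M] (hα : 0 < α) (hβ : 0 < β)
    (ha : IsBFEnumeration e α len a) (e' : (jumpLanguage L len).Symbols ↪ ℕ) :
    scottRank (StructuralJump e α a) e' ≤ β ↔ scottRank M e ≤ α + β := by
  rw [scottRank_le_iff, scottRank_le_iff]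
  exact forall_congr' fun n => forall_congr' fun b => not_congr (isFree_jump_iff hα hβ ha e' b)

/-- The Scott rank of the `α`-jump is `max 1 (SR - α)`. -/
theorem scottRank_jump [Countable M] (hα : 0 < α) (ha : IsBFEnumeration e α len a)
    (e' : (jumpLanguage L len).Symbols ↪ ℕ) :
    scottRank (StructuralJump e α a) e' = max 1 (scottRank M e - α) := by
  refine eq_of_forall_ge_iff fun β => ?_
  rcases eq_or_ne β 0 with rfl | hβ
  · exact iff_of_false (scottRank_pos e').not_ge (by simp)
  · have hβ := pos_iff_ne_zero.2 hβ
    rw [scottRank_jump_le_iff hα hβ ha e', max_le_iff, Order.one_le_iff_pos, Ordinal.sub_le]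
    exact (and_iff_right hβ).symm

end Jump

end ScottJump
theorem mainTheorem8 {L : FirstOrder.Language.{u, v}} {M : Type w} [L.Structure M] [Countable M]
    (e : L.Symbols ↪ ℕ) (α β : Ordinal.{0}) (hα : 0 < α) (hα₁ : α < ω₁) (hβ : 0 < β)
    (hβ₁ : β < ω₁) {ι : Type x} (len : ι → ℕ) (a : (i : ι) → Fin (len i) → M)
    (ha : ScottJump.IsBFEnumeration e α len a)
    (e' : (ScottJump.jumpLanguage L len).Symbols ↪ ℕ) :
    ((1 < β ∨ α < ScottJump.scottRank M e) →
      (ScottJump.scottRank M e = α + β ↔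
        ScottJump.scottRank (ScottJump.StructuralJump e α a) e' = β)) ∧
    (ScottJump.scottRank M e ≤ α →
      ScottJump.scottRank (ScottJump.StructuralJump e α a) e' = 1) := by
  rw [ScottJump.scottRank_jump hα ha e']
  constructor
  · rintro h
    rcases lt_or_ge α (ScottJump.scottRank M e) with hlt | hle
    · have hpos : 1 ≤ ScottJump.scottRank M e - α := by
        rwa [Order.one_le_iff_pos, Ordinal.lt_sub, add_zero]
      rw [max_eq_right hpos, ← add_right_inj (a := α) (b := _ - α),
        Ordinal.add_sub_cancel_of_le hlt.le]
    -- Here the jump has rank 1 and `SR ≤ α < α + β`, so both sides are false exactly because `β ≠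
    -- 1`.
    · have hβ' := h.resolve_right hle.not_gt
      rw [Ordinal.sub_eq_zero_iff_le.2 hle, max_eq_left zero_le]
      refine iff_of_false (fun heq => ?_) hβ'.ne
      exact ((lt_add_of_pos_right α hβ).trans_le (heq.ge.trans hle)).false
  · intro h
    rw [Ordinal.sub_eq_zero_iff_le.2 h, max_eq_left zero_le]
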